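/- A Borel probability measure $\mu$ on $\mathbb{R}^n$ is called log-concave if $\mu(H)<1$ for every (affine) hyperplane $H$ and $\mu(\lambda A+(1-\lambda)B)\ge \mu(A)^{\lambda}\mu(B)^{1-\lambda}$ for all compact $A,B\subseteq\mathbb{R}^n$ and all $\lambda\in(0,1)$; it is called centered if $\int\langle x,\xi\rangle\,d\mu(x)=0$ for all $\xi\in\mathbb{R}^n$. Given $\mu$ and $N\in\mathbb{N}$, let $X_1,\ldots,X_N$ be independent random points distributed according to $\mu$, let $K_N=\mathrm{conv}\{X_1,\ldots,X_N\}$, and write $\mathbb{E}_{\mu^N}$ for the expectation with respect to the law $\mu^N$ of $(X_1,\ldots,X_N)$. There exists an absolute constant $C>0$ such that for every $\delta\in(0,1)$ $$\lim_{n\to\infty}\ \inf_{\mu}\ \inf\Big\{\mathbb{E}_{\mu^N}\big[\mu((1+\delta)K_N)\big] : N\in\mathbb{N},\ N\ge \exp\big(C\,\delta^{-1}\ln(2/\delta)\,n\ln n\big)\Big\}=1,$$ where the first infimum is over all centered log-concave probability measures $\mu$ on $\mathbb{R}^n$. -/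

import Mathlib

open MeasureTheory Filter Topology
open scoped Pointwise ENNReal

/-- A Borel measure `μ` on `ℝⁿ` is log-concave if it is non-degenerate (every affine hyperplane
`{x | ⟪a, x⟫ = b}`, `a ≠ 0`, has measure less than one) and
`μ (t A + (1 - t) B) ≥ μ(A)^t μ(B)^(1 - t)` for all compact `A`, `B` and all `t ∈ (0, 1)`. -/
structure IsLogConcaveMeasure {n : ℕ} (μ : Measure (EuclideanSpace ℝ (Fin n))) : Prop where
  hyperplane_lt_one : ∀ (a : EuclideanSpace ℝ (Fin n)) (b : ℝ), a ≠ 0 →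
    μ {x | inner ℝ a x = b} < 1
  rpow_mul_rpow_le : ∀ A B : Set (EuclideanSpace ℝ (Fin n)), IsCompact A → IsCompact B →
    ∀ t : ℝ, 0 < t → t < 1 → μ A ^ t * μ B ^ (1 - t) ≤ μ (t • A + (1 - t) • B)

/-- `μ` is centered: every linear functional has mean zero, that is, the barycenter is the origin.
(Log-concave probability measures have finite moments of all orders, so these integrals converge
for every measure to which this notion is applied.) -/
def IsCenteredMeasure {n : ℕ} (μ : Measure (EuclideanSpace ℝ (Fin n))) : Prop :=
  ∀ ξ : EuclideanSpace ℝ (Fin n), ∫ x, inner ℝ x ξ ∂μ = 0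

/-- The random polytope `K_N = conv {X_1, …, X_N}` spanned by `N` points of `ℝⁿ`. -/
def randomPolytope {n N : ℕ} (X : Fin N → EuclideanSpace ℝ (Fin n)) :
    Set (EuclideanSpace ℝ (Fin n)) :=
  convexHull ℝ (Set.range X)

/-- The expectation of `μ (r K_N)`, where the `N` vertices of `K_N` are independent with law `μ`,
i.e. `(X_1, …, X_N)` is distributed according to the product measure `μ^N`. -/
noncomputable def expectedMeasureDilate {n : ℕ} (μ : Measure (EuclideanSpace ℝ (Fin n)))
    (N : ℕ) (r : ℝ) : ℝ≥0∞ :=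
  ∫⁻ X : Fin N → EuclideanSpace ℝ (Fin n), μ (r • randomPolytope X) ∂(Measure.pi fun _ => μ)

/-! Lower bound. The norm `v ↦ ∫ |⟪x, v⟫| dμ` has an Auerbach basis `b`, so a vector whose largest
coordinate in `b` is `±1` has norm at least one. A centered log-concave marginal exceeds an eighth
of its mean absolute value with probability at least `1/32`
(`IsLogConcaveMeasure.le_measure_integral_abs_le`). Discretizing the boundary of the coordinate cube
gives about `(2048 n)^n` caps of measure at least `1/64`. If all of them are hit, `K_N` contains the
cross-polytope `∑ |⟪x, b i⟫| ≤ 1/16` (`mem_randomPolytope_of_sum_abs_inner_le`).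

Now cut space into cells of mesh `δ / (16 n)` in the values `⟪x, b i⟫`. A point sharing a cell with
some `X j` differs from it by an element of `δ K_N`, so it lies in `K_N + δ K_N = (1 + δ) K_N`. A
cell of measure `p` contributes at most `p (1 - p)^N ≤ 1/N` to the expected missed mass, however
small `p` is. Only polynomially large grids to the power `n` are needed, so `N ≥ n ^ (4 n + 1)`
leaves an error of at most `66 / n`, uniformly in `μ`.

Upper bound. An infimum over an empty family would be `∞`, so each dimension needs an admissible
measure: the uniform law on a cube, log-concave by Prékopa–Leindler. -/

/-! ### Brunn–Minkowski and Prékopa–Leindler for uniform distributions. -/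

/-- One-dimensional Brunn–Minkowski inequality for compact sets. -/
theorem volume_add_le_of_isCompact {K L C : Set ℝ} (hK : IsCompact K) (hL : IsCompact L)
    (hKn : K.Nonempty) (hLn : L.Nonempty) {t : ℝ} (ht0 : 0 < t) (ht1 : t < 1)
    (h : ∀ x ∈ K, ∀ y ∈ L, t * x + (1 - t) * y ∈ C) :
    ENNReal.ofReal t * volume K + ENNReal.ofReal (1 - t) * volume L ≤ volume C := by
  have key : ∀ (s c : ℝ) (A : Set ℝ), 0 < s →
      volume ((fun x => s * x + c) '' A) = ENNReal.ofReal s * volume A := by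
    intro s c A hs
    have : (fun x => s * x + c) '' A = (fun x => x + c) '' (s • A) := by
      rw [← Set.image_smul, Set.image_image]; simp
    rw [this, Set.image_add_right, measure_preimage_add_right, Measure.addHaar_smul]
    simp [abs_of_pos hs]
  set M := sSup K
  set m := sInf L
  have hM := hK.sSup_mem hKn
  have hm := hL.sInf_mem hLn
  -- Translates of `t K` and `(1 - t) L` inside `C`, placed so that the top of `P` is the bottom of
  -- `Q`; they share at most that one point.
  set P := (fun x => t * x + (1 - t) * m) '' K
  set Q := (fun y => (1 - t) * y + t * M) '' L
  have hQc : IsCompact Q := hL.image (by fun_prop)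
  have hPQ : P ∪ Q ⊆ C := by
    rintro z (⟨x, hx, rfl⟩ | ⟨y, hy, rfl⟩)
    · exact h x hx m hm
    · have := h M hM y hy
      rwa [add_comm] at this
  have hint : volume (P ∩ Q) = 0 := by
    refine measure_mono_null (t := {t * M + (1 - t) * m}) ?_ (by simp)
    rintro z ⟨⟨x, hx, rfl⟩, ⟨y, hy, hxy⟩⟩
    have h1 : x ≤ M := le_csSup hK.bddAbove hx
    have h2 : m ≤ y := csInf_le hL.bddBelow hy
    simp only [Set.mem_singleton_iff] at hxy ⊢
    nlinarith [mul_le_mul_of_nonneg_left h1 ht0.le,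
      mul_le_mul_of_nonneg_left h2 (sub_pos.2 ht1).le]
  have := measure_union_add_inter (μ := volume) P hQc.measurableSet
  rw [hint, add_zero, key _ _ _ ht0, key _ _ _ (sub_pos.2 ht1)] at this
  rw [← this]
  exact measure_mono hPQ

/-- One-dimensional Brunn–Minkowski inequality for nonempty measurable sets of finite measure. -/
theorem volume_add_le_of_measurableSet {A B C : Set ℝ} (hA : MeasurableSet A)
    (hB : MeasurableSet B) (hAn : A.Nonempty) (hBn : B.Nonempty) (hA' : volume A ≠ ∞)
    (hB' : volume B ≠ ∞) {t : ℝ} (ht0 : 0 < t) (ht1 : t < 1)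
    (h : ∀ x ∈ A, ∀ y ∈ B, t * x + (1 - t) * y ∈ C) :
    ENNReal.ofReal t * volume A + ENNReal.ofReal (1 - t) * volume B ≤ volume C := by
  have key : ∀ {A : Set ℝ}, MeasurableSet A → A.Nonempty → volume A ≠ ∞ → ∀ ε : ℝ≥0∞, ε ≠ 0 →
      ∃ K ⊆ A, IsCompact K ∧ K.Nonempty ∧ volume A ≤ volume K + ε := by
    rintro A hA ⟨a, ha⟩ hA' ε hε
    obtain ⟨K, hKA, hK, hlt⟩ := hA.exists_isCompact_lt_add hA' hε
    -- Inner regularity may return the empty set; adding one point keeps the approximant nonempty.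
    refine ⟨insert a K, Set.insert_subset ha hKA, hK.insert a, Set.insert_nonempty _ _,
      hlt.le.trans ?_⟩
    gcongr
    exact Set.subset_insert _ _
  refine ENNReal.le_of_forall_pos_le_add fun ε hε _ => ?_
  have hε' : (ε : ℝ≥0∞) ≠ 0 := by exact_mod_cast hε.ne'
  obtain ⟨K, hKA, hK, hKn, hK'⟩ := key hA hAn hA' ε hε'
  obtain ⟨L, hLB, hL, hLn, hL'⟩ := key hB hBn hB' ε hε'
  have hsum : ENNReal.ofReal t + ENNReal.ofReal (1 - t) = 1 := by
    rw [← ENNReal.ofReal_add ht0.le (sub_pos.2 ht1).le]; simp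
  calc ENNReal.ofReal t * volume A + ENNReal.ofReal (1 - t) * volume B
      ≤ ENNReal.ofReal t * (volume K + ε) + ENNReal.ofReal (1 - t) * (volume L + ε) := by gcongr
    _ = ENNReal.ofReal t * volume K + ENNReal.ofReal (1 - t) * volume L +
        (ENNReal.ofReal t + ENNReal.ofReal (1 - t)) * ε := by ring
    _ ≤ volume C + ε := by
        rw [hsum, one_mul]
        gcongr
        exact volume_add_le_of_isCompact hK hL hKn hLn ht0 ht1
          fun x hx y hy => h x (hKA hx) y (hLB hy)

/-- The uniform distribution on `[-1/2, 1/2]`. -/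
noncomputable def centeredUnif : Measure ℝ := volume.restrict (Set.Icc (-(1 / 2)) (1 / 2))

instance : IsProbabilityMeasure centeredUnif := by
  constructor
  simp [centeredUnif]
  norm_num

/-- Convexity of the interval lets all three sets be intersected with it; positive measure supplies
the nonemptiness that Brunn–Minkowski needs. -/
theorem centeredUnif_add_le {A B C : Set ℝ} (hA : MeasurableSet A)
    (hB : MeasurableSet B) (hAn : centeredUnif A ≠ 0) (hBn : centeredUnif B ≠ 0)
    {t : ℝ} (ht0 : 0 < t) (ht1 : t < 1)
    (h : ∀ x ∈ A, ∀ y ∈ B, t * x + (1 - t) * y ∈ C) :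
    ENNReal.ofReal t * centeredUnif A + ENNReal.ofReal (1 - t) * centeredUnif B ≤
      centeredUnif C := by
  have hfin : ∀ s : Set ℝ, volume (s ∩ Set.Icc (-(1 / 2)) (1 / 2)) ≠ ∞ := fun s =>
    ((measure_mono Set.inter_subset_right).trans_lt (by simp)).ne
  simp only [centeredUnif, Measure.restrict_apply' measurableSet_Icc] at *
  refine volume_add_le_of_measurableSet (hA.inter measurableSet_Icc) (hB.inter measurableSet_Icc)
    (nonempty_of_measure_ne_zero hAn) (nonempty_of_measure_ne_zero hBn) (hfin _) (hfin _) ht0 ht1 ?_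
  rintro x ⟨hx, hx'⟩ y ⟨hy, hy'⟩
  exact ⟨h x hx y hy, (convex_Icc _ _) hx' hy' ht0.le (sub_pos.2 ht1).le (by ring)⟩

/-- Layer cake formula for a function with values in `[0, 1]` almost everywhere. -/
theorem lintegral_eq_lintegral_meas_Ioo {α : Type*} [MeasurableSpace α] (ν : Measure α)
    {f : α → ℝ≥0∞} (hf : Measurable f) (hf1 : ∀ᵐ x ∂ν, f x ≤ 1) :
    ∫⁻ x, f x ∂ν = ∫⁻ s in Set.Ioo (0 : ℝ) 1, ν {x | ENNReal.ofReal s ≤ f x} := by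
  have h0 : ∫⁻ x, f x ∂ν = ∫⁻ x, ENNReal.ofReal (min (f x) 1).toReal ∂ν := by
    refine lintegral_congr_ae (hf1.mono fun x hx => ?_)
    dsimp only
    rw [min_eq_left hx, ENNReal.ofReal_toReal (ne_top_of_le_ne_top ENNReal.one_ne_top hx)]
  rw [h0, lintegral_eq_lintegral_meas_le ν (ae_of_all _ fun _ => ENNReal.toReal_nonneg)
    (by fun_prop)]
  have h1 : ∀ s : ℝ, 0 < s → {x | s ≤ (min (f x) 1).toReal} = {x | ENNReal.ofReal s ≤ min (f x) 1} :=
    fun s hs => by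
      ext x
      exact (ENNReal.ofReal_le_iff_le_toReal
        (ne_top_of_le_ne_top ENNReal.one_ne_top (min_le_right _ _))).symm
  rw [← Set.Ioo_union_Ici_eq_Ioi (zero_lt_one' ℝ), lintegral_union measurableSet_Ici
    (Set.disjoint_left.2 fun x hx hx' => absurd hx.2 (not_lt.2 hx'))]
  have h2 : ∫⁻ s in Set.Ici (1 : ℝ), ν {x | s ≤ (min (f x) 1).toReal} = 0 := by
    rw [setLIntegral_congr Ioi_ae_eq_Ici.symm]
    rw [setLIntegral_congr_fun (g := fun _ => 0) measurableSet_Ioi]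
    · simp
    · intro s hs
      have : {x | s ≤ (min (f x) 1).toReal} = ∅ := by
        ext x
        have : (min (f x) 1).toReal ≤ 1 :=
          ENNReal.toReal_le_of_le_ofReal zero_le_one (by simp)
        have hs' : 1 < s := hs
        simp only [Set.mem_ofPred_eq, Set.mem_empty_iff_false, iff_false, not_le]
        linarith
      simp [this]
  rw [h2, add_zero]
  refine setLIntegral_congr_fun measurableSet_Ioo fun s hs => ?_
  rw [h1 s hs.1]
  congr 1
  ext x
  simp [hs.2.le]

theorem ENNReal.rpow_mul_rpow_le_add {t : ℝ} (ht0 : 0 < t) (ht1 : t < 1) (a b : ℝ≥0∞) :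
    a ^ t * b ^ (1 - t) ≤ ENNReal.ofReal t * a + ENNReal.ofReal (1 - t) * b := by
  have h1 : 0 < 1 - t := sub_pos.2 ht1
  rcases eq_or_ne a ∞ with rfl | ha
  · rw [ENNReal.mul_top (by simpa using ht0)]; simp
  rcases eq_or_ne b ∞ with rfl | hb
  · rw [ENNReal.mul_top (by simpa using h1)]; simp
  lift a to NNReal using ha
  lift b to NNReal using hb
  rw [← ENNReal.coe_rpow_of_nonneg _ ht0.le, ← ENNReal.coe_rpow_of_nonneg _ h1.le]
  simp only [ENNReal.ofReal]
  norm_cast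
  have := NNReal.geom_mean_le_arith_mean2_weighted t.toNNReal (1 - t).toNNReal a b
    (by rw [← Real.toNNReal_add ht0.le h1.le]; simp)
  simpa [Real.coe_toNNReal _ ht0.le, Real.coe_toNNReal _ h1.le] using this

/-- Makes Brunn–Minkowski applicable to every superlevel set strictly below the essential supremum.
-/
theorem measure_ofReal_mul_essSup_le_ne_zero {α : Type*} [MeasurableSpace α] (ν : Measure α)
    {f : α → ℝ≥0∞} (h0 : essSup f ν ≠ 0) (h1 : essSup f ν ≠ ∞) {s : ℝ} (hs : s < 1) :
    ν {x | ENNReal.ofReal s * essSup f ν ≤ f x} ≠ 0 := by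
  intro h
  have hlt : ENNReal.ofReal s * essSup f ν < essSup f ν := by
    conv_rhs => rw [← one_mul (essSup f ν)]
    exact ENNReal.mul_lt_mul_left h0 h1 (by simpa using hs)
  refine absurd (essSup_le_of_ae_le (μ := ν) (f := f) (ENNReal.ofReal s * essSup f ν) ?_)
    (not_le.2 hlt)
  have h' : ∀ᵐ x ∂ν, ¬ (ENNReal.ofReal s * essSup f ν ≤ f x) := by
    rw [ae_iff]; simpa using h
  exact h'.mono fun x hx => (not_le.1 hx).le

/-- One-dimensional Prékopa–Leindler inequality for bounded functions and the uniform
distribution. -/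
theorem centeredUnif_prekopa_leindler {t : ℝ} (ht0 : 0 < t) (ht1 : t < 1) {f g h : ℝ → ℝ≥0∞}
    (hf : Measurable f) (hg : Measurable g) (hh : Measurable h) (hf1 : ∀ x, f x ≤ 1)
    (hg1 : ∀ x, g x ≤ 1) (hfgh : ∀ x y, f x ^ t * g y ^ (1 - t) ≤ h (t * x + (1 - t) * y)) :
    (∫⁻ x, f x ∂centeredUnif) ^ t * (∫⁻ x, g x ∂centeredUnif) ^ (1 - t) ≤
      ∫⁻ x, h x ∂centeredUnif := by
  have hs1 : 0 < 1 - t := sub_pos.2 ht1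
  by_cases hf0 : ∫⁻ x, f x ∂centeredUnif = 0
  · simp [hf0, ENNReal.zero_rpow_of_pos ht0]
  by_cases hg0 : ∫⁻ x, g x ∂centeredUnif = 0
  · simp [hg0, ENNReal.zero_rpow_of_pos hs1]
  have hes : ∀ {f : ℝ → ℝ≥0∞}, (∀ x, f x ≤ 1) → ∫⁻ x, f x ∂centeredUnif ≠ 0 →
      essSup f centeredUnif ≠ 0 ∧ essSup f centeredUnif ≠ ∞ := by
    intro f hf1 hf0
    constructor
    · intro h0
      refine hf0 (lintegral_eq_zero_of_ae_eq_zero ?_)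
      filter_upwards [ENNReal.ae_le_essSup (μ := centeredUnif) f] with x hx
      simpa [h0] using hx
    · exact ne_top_of_le_ne_top ENNReal.one_ne_top (essSup_le_of_ae_le _ (ae_of_all _ hf1))
  obtain ⟨ha0, ha⟩ := hes hf1 hf0
  obtain ⟨hb0, hb⟩ := hes hg1 hg0
  have hfl := ENNReal.ae_le_essSup (μ := centeredUnif) f
  have hgl := ENNReal.ae_le_essSup (μ := centeredUnif) g
  have hfp : ∀ s : ℝ, s < 1 → _ := fun s hs =>
    measure_ofReal_mul_essSup_le_ne_zero centeredUnif ha0 ha hs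
  have hgp : ∀ s : ℝ, s < 1 → _ := fun s hs =>
    measure_ofReal_mul_essSup_le_ne_zero centeredUnif hb0 hb hs
  -- Dividing `f` and `g` by their essential suprema makes their level sets nonnull for the same `s
  -- ∈ (0, 1)`; `c` is the matching scale for `h`.
  set a := essSup f centeredUnif
  set b := essSup g centeredUnif
  set c := a ^ t * b ^ (1 - t) with hc
  have hat0 : a ^ t ≠ 0 := by simp [ENNReal.rpow_eq_zero_iff, ha0, ha]
  have hbt0 : b ^ (1 - t) ≠ 0 := by simp [ENNReal.rpow_eq_zero_iff, hb0, hb]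
  have hat : a ^ t ≠ ∞ := ENNReal.rpow_ne_top_of_nonneg ht0.le ha
  have hbt : b ^ (1 - t) ≠ ∞ := ENNReal.rpow_ne_top_of_nonneg hs1.le hb
  have hc0 : c ≠ 0 := mul_ne_zero hat0 hbt0
  have hct : c ≠ ∞ := ENNReal.mul_ne_top hat hbt
  have hlayer : ∀ {f : ℝ → ℝ≥0∞} {a : ℝ≥0∞}, Measurable f → a ≠ 0 → a ≠ ∞ →
      (∀ᵐ x ∂centeredUnif, f x ≤ a) → (∫⁻ x, f x ∂centeredUnif) / a =
        ∫⁻ s in Set.Ioo (0 : ℝ) 1, centeredUnif {x | ENNReal.ofReal s * a ≤ f x} := by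
    intro f a hf ha0 ha hfa
    rw [div_eq_mul_inv, ← lintegral_mul_const _ hf,
      lintegral_eq_lintegral_meas_Ioo _ (hf.mul_const _)]
    · refine lintegral_congr fun s => ?_
      congr 1
      ext x
      exact ENNReal.le_div_iff_mul_le (Or.inl ha0) (Or.inl ha)
    · exact hfa.mono fun x hx => ENNReal.div_le_of_le_mul (by simpa using hx)
  have hmain : ENNReal.ofReal t * ((∫⁻ x, f x ∂centeredUnif) / a) +
      ENNReal.ofReal (1 - t) * ((∫⁻ x, g x ∂centeredUnif) / b) ≤
      (∫⁻ x, h x ∂centeredUnif) / c := by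
    calc _ ≤ ∫⁻ s in Set.Ioo (0 : ℝ) 1,
          (ENNReal.ofReal t * centeredUnif {x | ENNReal.ofReal s * a ≤ f x} +
            ENNReal.ofReal (1 - t) * centeredUnif {x | ENNReal.ofReal s * b ≤ g x}) := by
          rw [hlayer hf ha0 ha hfl, hlayer hg hb0 hb hgl]
          exact (add_le_add (lintegral_const_mul_le _ _) (lintegral_const_mul_le _ _)).trans
            (le_lintegral_add _ _)
      -- `h` may exceed `c`; truncating it keeps the layer cake formula on `(0, 1)` exact.
      _ ≤ ∫⁻ s in Set.Ioo (0 : ℝ) 1, centeredUnif {x | ENNReal.ofReal s * c ≤ min (h x) c} := by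
          refine setLIntegral_mono' measurableSet_Ioo fun s hs => ?_
          refine centeredUnif_add_le (measurableSet_le measurable_const hf)
            (measurableSet_le measurable_const hg) (hfp s hs.2) (hgp s hs.2) ht0 ht1 ?_
          intro x hx y hy
          have hx' : ENNReal.ofReal s * a ≤ f x := hx
          have hy' : ENNReal.ofReal s * b ≤ g y := hy
          refine le_min (le_trans ?_ (hfgh x y)) ?_
          · calc ENNReal.ofReal s * c
                = (ENNReal.ofReal s * a) ^ t * (ENNReal.ofReal s * b) ^ (1 - t) := by
                  rw [ENNReal.mul_rpow_of_nonneg _ _ ht0.le, ENNReal.mul_rpow_of_nonneg _ _ hs1.le,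
                    mul_mul_mul_comm, ← ENNReal.rpow_add_of_nonneg _ _ ht0.le hs1.le]
                  simp [hc]
              _ ≤ _ := mul_le_mul' (ENNReal.rpow_le_rpow hx' ht0.le)
                  (ENNReal.rpow_le_rpow hy' hs1.le)
          · exact mul_le_of_le_one_left' (by simpa using hs.2.le)
      _ = (∫⁻ x, min (h x) c ∂centeredUnif) / c :=
          (hlayer (hh.min measurable_const) hc0 hct (ae_of_all _ fun x => min_le_right _ _)).symm
      _ ≤ _ := ENNReal.div_le_div_right (lintegral_mono fun x => min_le_left _ _) _
  have := (ENNReal.rpow_mul_rpow_le_add ht0 ht1 _ _).trans hmain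
  rw [ENNReal.div_rpow_of_nonneg _ _ ht0.le, ENNReal.div_rpow_of_nonneg _ _ hs1.le,
    ← ENNReal.mul_div_mul_comm (Or.inl hat0) (Or.inl hat), ← hc] at this
  calc _ = (∫⁻ x, f x ∂centeredUnif) ^ t * (∫⁻ x, g x ∂centeredUnif) ^ (1 - t) / c * c :=
        (ENNReal.div_mul_cancel hc0 hct).symm
    _ ≤ (∫⁻ x, h x ∂centeredUnif) / c * c := by gcongr
    _ = _ := ENNReal.div_mul_cancel hc0 hct

/-- Prékopa–Leindler inequality for bounded functions and the uniform distribution on a cube. -/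
theorem pi_centeredUnif_prekopa_leindler {t : ℝ} (ht0 : 0 < t) (ht1 : t < 1) (n : ℕ) :
    ∀ f g h : (Fin n → ℝ) → ℝ≥0∞, Measurable f → Measurable g → Measurable h →
      (∀ x, f x ≤ 1) → (∀ x, g x ≤ 1) →
      (∀ x y, f x ^ t * g y ^ (1 - t) ≤ h (t • x + (1 - t) • y)) →
      (∫⁻ x, f x ∂Measure.pi fun _ => centeredUnif) ^ t *
        (∫⁻ x, g x ∂Measure.pi fun _ => centeredUnif) ^ (1 - t) ≤
        ∫⁻ x, h x ∂Measure.pi fun _ => centeredUnif := by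
  induction n with
  | zero =>
    intro f g h hf hg hh _ _ hfgh
    simp only [lintegral_unique, measure_univ, mul_one]
    convert hfgh default default
  | succ n ih =>
    intro f g h hf hg hh hf1 hg1 hfgh
    have hcons : Measurable fun p : ℝ × (Fin n → ℝ) => (Fin.cons p.1 p.2 : Fin (n + 1) → ℝ) := by
      refine measurable_pi_lambda _ fun i => ?_
      refine Fin.cases ?_ (fun j => ?_) i
      · simpa using measurable_fst
      · simp only [Fin.cons_succ]; fun_prop
    have hsplit : ∀ f : (Fin (n + 1) → ℝ) → ℝ≥0∞, Measurable f →
        ∫⁻ x, f x ∂(Measure.pi fun _ => centeredUnif) =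
          ∫⁻ a, ∫⁻ y, f (Fin.cons a y) ∂(Measure.pi fun _ => centeredUnif) ∂centeredUnif := by
      intro f hf
      rw [← ((measurePreserving_piFinSuccAbove (fun _ => centeredUnif) 0).symm _).lintegral_comp hf,
        lintegral_prod]
      · simp [MeasurableEquiv.piFinSuccAbove, Fin.consEquiv]
      · exact (hf.comp (MeasurableEquiv.measurable _)).aemeasurable
    have hslice : ∀ {f : (Fin (n + 1) → ℝ) → ℝ≥0∞}, Measurable f → ∀ a,
        Measurable fun y : Fin n → ℝ => f (Fin.cons a y) := fun hf a =>
      hf.comp (hcons.comp measurable_prodMk_left)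
    have hmarg : ∀ {f : (Fin (n + 1) → ℝ) → ℝ≥0∞}, Measurable f → Measurable fun a =>
        ∫⁻ y, f (Fin.cons a y) ∂(Measure.pi fun _ : Fin n => centeredUnif) := fun hf =>
      (hf.comp hcons).lintegral_prod_right'
    have hle : ∀ {f : (Fin (n + 1) → ℝ) → ℝ≥0∞}, (∀ x, f x ≤ 1) → ∀ a,
        ∫⁻ y, f (Fin.cons a y) ∂(Measure.pi fun _ : Fin n => centeredUnif) ≤ 1 := fun hf1 a =>
      (lintegral_mono fun y => hf1 _).trans (by simp)
    rw [hsplit f hf, hsplit g hg, hsplit h hh]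
    -- The induction hypothesis on slices is exactly the one-dimensional hypothesis for the
    -- marginals.
    refine centeredUnif_prekopa_leindler ht0 ht1 (hmarg hf) (hmarg hg) (hmarg hh) (hle hf1)
      (hle hg1) fun a b => ?_
    refine ih _ _ _ (hslice hf a) (hslice hg b) (hslice hh _) (fun _ => hf1 _) (fun _ => hg1 _) ?_
    intro x y
    convert hfgh (Fin.cons a x) (Fin.cons b y) using 2
    ext i
    refine Fin.cases ?_ (fun j => ?_) i <;> simp

/-! ### The cube as a centered log-concave measure. -/

instance : centeredUnif.IsNegInvariant := by
  constructor
  have := (Measure.measurePreserving_neg (volume : Measure ℝ)).restrict_preimage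
    (measurableSet_Icc (a := -(1 / 2 : ℝ)) (b := 1 / 2))
  simpa [Measure.neg, centeredUnif] using this.map_eq

/-- The uniform distribution on the cube `[-1/2, 1/2]ⁿ` of Euclidean space. -/
noncomputable def cubeMeasure (n : ℕ) : Measure (EuclideanSpace ℝ (Fin n)) :=
  (Measure.pi fun _ : Fin n => centeredUnif).map (WithLp.toLp 2)

theorem measurable_toLp_two (n : ℕ) :
    Measurable (WithLp.toLp 2 : (Fin n → ℝ) → EuclideanSpace ℝ (Fin n)) :=
  (PiLp.volume_preserving_toLp (Fin n)).measurable

instance (n : ℕ) : IsProbabilityMeasure (cubeMeasure n) :=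
  Measure.isProbabilityMeasure_map (measurable_toLp_two n).aemeasurable

theorem cubeMeasure_absolutelyContinuous (n : ℕ) : cubeMeasure n ≪ volume := by
  rw [← (PiLp.volume_preserving_toLp (Fin n)).map_eq, cubeMeasure]
  refine Measure.AbsolutelyContinuous.map ?_ (measurable_toLp_two n)
  rw [volume_pi]
  simp only [centeredUnif]
  rw [← Measure.restrict_pi_pi]
  exact Measure.restrict_le_self.absolutelyContinuous

theorem isLogConcaveMeasure_cubeMeasure (n : ℕ) : IsLogConcaveMeasure (cubeMeasure n) where
  hyperplane_lt_one a b ha := by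
    have : cubeMeasure n {x | inner ℝ a x = b} = 0 := by
      apply cubeMeasure_absolutelyContinuous
      set s : AffineSubspace ℝ (EuclideanSpace ℝ (Fin n)) :=
        (AffineSubspace.mk' b (⊥ : Submodule ℝ ℝ)).comap
          (innerSL ℝ a).toLinearMap.toAffineMap with hs
      have hmem : ∀ x, x ∈ s ↔ inner ℝ a x = b := fun x => by
        simp [hs, AffineSubspace.mem_mk', sub_eq_zero]
      have : {x | inner ℝ a x = b} = (s : Set (EuclideanSpace ℝ (Fin n))) := by
        ext x; simp [← hmem]
      rw [this]
      refine Measure.addHaar_affineSubspace _ _ fun htop => ha ?_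
      have h0 : inner ℝ a (0 : EuclideanSpace ℝ (Fin n)) = b := (hmem 0).1 (by simp [htop])
      have ha' : inner ℝ a a = b := (hmem a).1 (by simp [htop])
      rw [inner_zero_right] at h0
      exact inner_self_eq_zero.1 (ha'.trans h0.symm)
    simp [this]
  rpow_mul_rpow_le A B hA hB t ht0 ht1 := by
    have hC : IsCompact (t • A + (1 - t) • B) := (hA.smul t).add (hB.smul (1 - t))
    have hm := measurable_toLp_two n
    have hval : ∀ S : Set (EuclideanSpace ℝ (Fin n)), IsCompact S → cubeMeasure n S =
        ∫⁻ x, S.indicator 1 (WithLp.toLp 2 x) ∂Measure.pi fun _ => centeredUnif := by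
      intro S hS
      rw [← lintegral_indicator_one hS.measurableSet, cubeMeasure,
        lintegral_map (measurable_one.indicator hS.measurableSet) hm]
    rw [hval A hA, hval B hB, hval _ hC]
    have hmeas : ∀ S : Set (EuclideanSpace ℝ (Fin n)), IsCompact S →
        Measurable fun x : Fin n → ℝ => S.indicator (1 : EuclideanSpace ℝ (Fin n) → ℝ≥0∞) (WithLp.toLp 2 x) :=
      fun S hS => (measurable_one.indicator hS.measurableSet).comp hm
    have hle : ∀ (S : Set (EuclideanSpace ℝ (Fin n))) (x : Fin n → ℝ),
        S.indicator (1 : EuclideanSpace ℝ (Fin n) → ℝ≥0∞) (WithLp.toLp 2 x) ≤ 1 :=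
      fun S x => Set.indicator_le_self' (f := 1) (by simp) _
    refine pi_centeredUnif_prekopa_leindler ht0 ht1 n _ _ _ (hmeas A hA) (hmeas B hB)
      (hmeas _ hC) (hle A) (hle B) fun x y => ?_
    by_cases hx : WithLp.toLp 2 x ∈ A
    · by_cases hy : WithLp.toLp 2 y ∈ B
      · have : WithLp.toLp 2 (t • x + (1 - t) • y) ∈ t • A + (1 - t) • B :=
          Set.add_mem_add (Set.smul_mem_smul_set hx) (Set.smul_mem_smul_set hy)
        rw [Set.indicator_of_mem this]
        simp [hx, hy]
      · simp [hy, ENNReal.zero_rpow_of_pos (sub_pos.2 ht1)]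
    · simp [hx, ENNReal.zero_rpow_of_pos ht0]

theorem isCenteredMeasure_cubeMeasure (n : ℕ) : IsCenteredMeasure (cubeMeasure n) := by
  intro ξ
  rw [cubeMeasure, integral_map (measurable_toLp_two n).aemeasurable
    (by fun_prop)]
  have h := integral_neg_eq_self (fun x : Fin n → ℝ => inner ℝ (WithLp.toLp 2 x) ξ)
    (Measure.pi fun _ => centeredUnif)
  simp only [WithLp.toLp_neg, inner_neg_left, integral_neg] at h
  linarith

/-! ### Auerbach bases. -/

/-- Auerbach's lemma: a continuous, absolutely homogeneous and positive function `N` admits a basis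
of `N`-unit vectors whose coordinate functionals are dominated by `N`. -/
theorem exists_auerbach_basis {n : ℕ} {N : EuclideanSpace ℝ (Fin n) → ℝ} (hN : Continuous N)
    (hsmul : ∀ (c : ℝ) v, N (c • v) = |c| * N v) (hpos : ∀ v, v ≠ 0 → 0 < N v) :
    ∃ b : Module.Basis (Fin n) ℝ (EuclideanSpace ℝ (Fin n)),
      (∀ i, N (b i) = 1) ∧ ∀ v i, |b.repr v i| ≤ N v := by
  let e := (EuclideanSpace.basisFun (Fin n) ℝ).toBasis
  let K : Set (Fin n → EuclideanSpace ℝ (Fin n)) := Set.univ.pi fun _ => Metric.sphere 0 1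
  -- This ratio is invariant under scaling each vector, so it can be maximized over the compact
  -- product of Euclidean spheres.
  let φ : (Fin n → EuclideanSpace ℝ (Fin n)) → ℝ := fun θ => |e.det θ| / ∏ i, N (θ i)
  have hne : ∀ {v : EuclideanSpace ℝ (Fin n)}, v ∈ Metric.sphere (0 : EuclideanSpace ℝ (Fin n)) 1 →
      v ≠ 0 := fun hv h => by simp [h] at hv
  have hdet : Continuous fun θ : Fin n → EuclideanSpace ℝ (Fin n) => e.det θ := by
    simp only [Module.Basis.det_apply]
    refine Continuous.matrix_det (continuous_matrix fun i j => ?_)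
    simp only [Module.Basis.toMatrix_apply]
    have : Continuous fun v : EuclideanSpace ℝ (Fin n) => e.repr v i :=
      (e.coord i).continuous_of_finiteDimensional
    exact this.comp (continuous_apply j)
  have hφ : ContinuousOn φ K := by
    refine ContinuousOn.div hdet.abs.continuousOn
      (continuous_finsetProd _ fun i _ => hN.comp (continuous_apply i)).continuousOn fun θ hθ => ?_
    exact (Finset.prod_pos fun i _ => hpos _ (hne (hθ i trivial))).ne'
  have hKe : ∀ i, e i ∈ Metric.sphere (0 : EuclideanSpace ℝ (Fin n)) 1 := fun i => by
    simp [e]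
  obtain ⟨θ, hθ, hmax⟩ := (isCompact_univ_pi fun _ => isCompact_sphere _ _).exists_isMaxOn
    (s := K) ⟨e, fun i _ => hKe i⟩ hφ
  have hNθ : ∀ i, 0 < N (θ i) := fun i => hpos _ (hne (hθ i trivial))
  have hdetθ : 0 < |e.det θ| := by
    have h1 : φ e ≤ φ θ := hmax (fun i _ => hKe i)
    have h2 : 0 < φ e := div_pos (by rw [e.det_self]; simp)
      (Finset.prod_pos fun i _ => hpos _ (hne (hKe i)))
    have h3 := h2.trans_le h1
    by_contra h
    have : |e.det θ| = 0 := le_antisymm (not_lt.1 h) (abs_nonneg _)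
    simp [φ, this] at h3
  obtain ⟨hli, hsp⟩ := (Module.Basis.is_basis_iff_det e).2 (isUnit_iff_ne_zero.2 (abs_pos.1 hdetθ))
  let b := Module.Basis.mk hli hsp.ge
  have hb : ∀ i, b i = θ i := fun i => by simp [b]
  have hcoef : ∀ v i, |b.repr v i| * N (θ i) ≤ N v := by
    intro v i
    -- Cramer's rule: with it, maximality of `φ θ` against replacing `θ i` bounds the coordinate.
    have hupd' : ∀ v, e.det (Function.update θ i v) = b.repr v i * e.det θ := by
      intro v
      conv_lhs => rw [← b.sum_repr v]
      rw [AlternatingMap.map_update_sum]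
      rw [Finset.sum_eq_single i]
      · rw [AlternatingMap.map_update_smul, hb, Function.update_eq_self, smul_eq_mul]
      · intro j _ hj
        rw [AlternatingMap.map_update_smul, hb,
          AlternatingMap.map_update_self _ _ hj.symm, smul_zero]
      · simp
    rcases eq_or_ne v 0 with rfl | hv
    · have h0 : N 0 = 0 := by simpa using hsmul 0 0
      simp [h0]
    have hunit : ∀ w ∈ Metric.sphere (0 : EuclideanSpace ℝ (Fin n)) 1,
        |b.repr w i| * N (θ i) ≤ N w := by
      intro w hw
      have hw' : Function.update θ i w ∈ K := by
        intro j _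
        rcases eq_or_ne j i with rfl | hj
        · simpa using hw
        · simpa [hj] using hθ j trivial
      have hprod : ∏ j, N (Function.update θ i w j) =
          N w * ∏ j ∈ Finset.univ.erase i, N (θ j) := by
        rw [← Finset.mul_prod_erase Finset.univ _ (Finset.mem_univ i), Function.update_self]
        congr 1
        refine Finset.prod_congr rfl fun j hj => ?_
        rw [Function.update_of_ne (Finset.ne_of_mem_erase hj)]
      have hle : φ (Function.update θ i w) ≤ φ θ := hmax hw'
      have hP : 0 < ∏ j ∈ Finset.univ.erase i, N (θ j) := Finset.prod_pos fun j _ => hNθ j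
      simp only [φ] at hle
      rw [hprod, hupd' w, ← Finset.mul_prod_erase Finset.univ (fun j => N (θ j))
        (Finset.mem_univ i), abs_mul, div_le_div_iff₀ (mul_pos (hpos _ (hne hw)) hP)
        (mul_pos (hNθ i) hP)] at hle
      refine le_of_mul_le_mul_left ?_ (mul_pos hdetθ hP)
      linarith
    have hnv : 0 < ‖v‖ := norm_pos_iff.2 hv
    have := hunit (‖v‖⁻¹ • v) (by simp [norm_smul, hnv.ne'])
    rw [hsmul, map_smul] at this
    simp only [Finsupp.smul_apply, smul_eq_mul, abs_mul, mul_assoc] at this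
    exact le_of_mul_le_mul_left this (by positivity)
  let u : Fin n → ℝˣ := fun i => Units.mk0 (N (θ i))⁻¹ (inv_pos.2 (hNθ i)).ne'
  refine ⟨b.unitsSMul u, fun i => ?_, fun v i => ?_⟩
  · rw [Module.Basis.unitsSMul_apply, hb, Units.smul_def, hsmul]
    simp [u, abs_of_pos (hNθ i), (hNθ i).ne']
  · rw [Module.Basis.repr_unitsSMul]
    simpa [u, Units.smul_def, abs_mul, abs_of_pos (hNθ i), mul_comm] using hcoef v i

/-! ### Tails and small-ball bounds for log-concave marginals. -/

section Tails

variable {n : ℕ} {μ : Measure (EuclideanSpace ℝ (Fin n))} [IsProbabilityMeasure μ]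

theorem IsLogConcaveMeasure.rpow_mul_rpow_le_of_isClosed (hμ : IsLogConcaveMeasure μ)
    {A B C : Set (EuclideanSpace ℝ (Fin n))} (hA : IsClosed A) (hB : IsClosed B)
    {t : ℝ} (ht0 : 0 < t) (ht1 : t < 1) (h : ∀ x ∈ A, ∀ y ∈ B, t • x + (1 - t) • y ∈ C) :
    μ A ^ t * μ B ^ (1 - t) ≤ μ C := by
  have hlim : ∀ A : Set (EuclideanSpace ℝ (Fin n)),
      Tendsto (fun k : ℕ => μ (A ∩ Metric.closedBall 0 k)) atTop (𝓝 (μ A)) := by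
    intro A
    have := tendsto_measure_iUnion_atTop (μ := μ)
      (s := fun k : ℕ => A ∩ Metric.closedBall (0 : EuclideanSpace ℝ (Fin n)) k) fun i j hij =>
        Set.inter_subset_inter_right _ (Metric.closedBall_subset_closedBall (by exact_mod_cast hij))
    rwa [← Set.inter_iUnion, Metric.iUnion_closedBall_nat, Set.inter_univ] at this
  have hs1 : 0 < 1 - t := sub_pos.2 ht1
  refine le_of_tendsto' (ENNReal.Tendsto.mul
    ((ENNReal.continuous_rpow_const (y := t)).tendsto _ |>.comp (hlim A))
    (Or.inr (ENNReal.rpow_ne_top_of_nonneg hs1.le (measure_ne_top _ _)))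
    ((ENNReal.continuous_rpow_const (y := 1 - t)).tendsto _ |>.comp (hlim B))
    (Or.inr (ENNReal.rpow_ne_top_of_nonneg ht0.le (measure_ne_top _ _)))) fun k => ?_
  refine (hμ.rpow_mul_rpow_le _ _ ((isCompact_closedBall _ _).inter_left hA)
    ((isCompact_closedBall _ _).inter_left hB) t ht0 ht1).trans (measure_mono ?_)
  rintro _ ⟨_, ⟨x, hx, rfl⟩, _, ⟨y, hy, rfl⟩, rfl⟩
  exact h x hx.1 y hy.1

theorem isClosed_halfSpace_ge (θ : EuclideanSpace ℝ (Fin n)) (s : ℝ) :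
    IsClosed {x : EuclideanSpace ℝ (Fin n) | s ≤ inner ℝ x θ} :=
  isClosed_le continuous_const (by fun_prop)

/-- Log-concavity with weight `1/(k+1)` on the far half-space and `k/(k+1)` on the near one, whose
weighted levels average to `b`; then raise to the power `k + 1`. -/
theorem IsLogConcaveMeasure.measure_halfSpace_mul_pow_le (hμ : IsLogConcaveMeasure μ)
    (θ : EuclideanSpace ℝ (Fin n)) (a b : ℝ) (k : ℕ) :
    μ {x | a + (k + 1) * (b - a) ≤ inner ℝ x θ} * μ {x | a ≤ inner ℝ x θ} ^ k ≤
      μ {x | b ≤ inner ℝ x θ} ^ (k + 1) := by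
  rcases Nat.eq_zero_or_pos k with rfl | hk
  · simp
  have hk' : (0 : ℝ) < k := by exact_mod_cast hk
  have ht0 : (0 : ℝ) < 1 / (k + 1) := by positivity
  have ht1 : (1 : ℝ) / (k + 1) < 1 := by rw [div_lt_one (by positivity)]; linarith
  have := hμ.rpow_mul_rpow_le_of_isClosed (isClosed_halfSpace_ge θ (a + (k + 1) * (b - a)))
    (isClosed_halfSpace_ge θ a) (C := {x | b ≤ inner ℝ x θ}) ht0 ht1 (by
      intro x hx y hy
      have hx' : a + (k + 1) * (b - a) ≤ inner ℝ x θ := hx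
      have hy' : a ≤ inner ℝ y θ := hy
      change b ≤ inner ℝ _ θ
      rw [inner_add_left, real_inner_smul_left, real_inner_smul_left]
      have h1 := mul_le_mul_of_nonneg_left hx' ht0.le
      have h2 := mul_le_mul_of_nonneg_left hy' (sub_pos.2 ht1).le
      have h3 : 1 / ((k : ℝ) + 1) * (a + (k + 1) * (b - a)) + (1 - 1 / (k + 1)) * a = b := by
        field_simp; ring
      linarith)
  have h := pow_le_pow_left' this (k + 1)
  rw [mul_pow, ← ENNReal.rpow_mul_natCast, ← ENNReal.rpow_mul_natCast] at h
  have e1 : 1 / ((k : ℝ) + 1) * ((k + 1 : ℕ) : ℝ) = 1 := by push_cast; field_simp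
  have e2 : (1 - 1 / ((k : ℝ) + 1)) * ((k + 1 : ℕ) : ℝ) = k := by push_cast; field_simp; ring
  rwa [e1, e2, ENNReal.rpow_one, ENNReal.rpow_natCast] at h

/-- For `y > b`, at least `⌊(y - a)/(b - a)⌋` steps of height `b - a` have been climbed, which loses
less than one step from `y - a`. -/
theorem ofReal_sub_le_tsum_indicator {a b : ℝ} (hab : a < b) (y : ℝ) :
    ENNReal.ofReal (y - b) ≤
      ∑' k : ℕ, {z : ℝ | a + (k + 1) * (b - a) ≤ z}.indicator (fun _ => ENNReal.ofReal (b - a)) y := by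
  have hd : 0 < b - a := sub_pos.2 hab
  rcases le_or_gt y b with hy | hy
  · simp [ENNReal.ofReal_of_nonpos (sub_nonpos.2 hy)]
  set j := ⌊(y - a) / (b - a)⌋₊
  have hj1 : (j : ℝ) ≤ (y - a) / (b - a) :=
    Nat.floor_le (div_nonneg (by linarith) hd.le)
  have hj2 : (y - a) / (b - a) < j + 1 := Nat.lt_floor_add_one _
  rw [le_div_iff₀ hd] at hj1
  rw [div_lt_iff₀ hd] at hj2
  calc ENNReal.ofReal (y - b) ≤ ENNReal.ofReal (j * (b - a)) :=
        ENNReal.ofReal_le_ofReal (by linarith)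
    _ = ∑ k ∈ Finset.range j, ENNReal.ofReal (b - a) := by
        rw [ENNReal.ofReal_mul (by positivity)]; simp
    _ = ∑ k ∈ Finset.range j, {z : ℝ | a + (k + 1) * (b - a) ≤ z}.indicator
          (fun _ => ENNReal.ofReal (b - a)) y := by
        refine Finset.sum_congr rfl fun k hk =>
          (Set.indicator_of_mem ?_ (fun _ : ℝ => ENNReal.ofReal (b - a))).symm
        have hkj : (k : ℝ) + 1 ≤ j := by exact_mod_cast Finset.mem_range.1 hk
        change a + (k + 1) * (b - a) ≤ y
        nlinarith
    _ ≤ _ := ENNReal.sum_le_tsum _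

/-- The tail at level `a + (k+1)(b-a)` is at most `q (2q)^k`; the staircase bound sums these as a
geometric series of ratio at most `1/2`. -/
theorem IsLogConcaveMeasure.lintegral_ofReal_inner_sub_le (hμ : IsLogConcaveMeasure μ)
    (θ : EuclideanSpace ℝ (Fin n)) {a b : ℝ} (hab : a < b)
    (ha : 2⁻¹ ≤ μ {x | a ≤ inner ℝ x θ}) {q : ℝ≥0∞} (hb : μ {x | b ≤ inner ℝ x θ} ≤ q)
    (hq : 2 * q ≤ 2⁻¹) :
    ∫⁻ x, ENNReal.ofReal (inner ℝ x θ - b) ∂μ ≤ ENNReal.ofReal (b - a) * (2 * q) := by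
  have hmeas : Measurable fun x : EuclideanSpace ℝ (Fin n) => inner ℝ x θ := by fun_prop
  have htail : ∀ k : ℕ, μ {x | a + (k + 1) * (b - a) ≤ inner ℝ x θ} ≤ q * (2 * q) ^ k := by
    intro k
    have h2 : (2 : ℝ≥0∞) ^ k * 2⁻¹ ^ k = 1 := by
      rw [← mul_pow, ENNReal.mul_inv_cancel (by simp) (by simp), one_pow]
    calc μ {x | a + (k + 1) * (b - a) ≤ inner ℝ x θ}
        = 2 ^ k * (μ {x | a + (k + 1) * (b - a) ≤ inner ℝ x θ} * 2⁻¹ ^ k) := by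
          rw [mul_left_comm, h2, mul_one]
      _ ≤ 2 ^ k * (μ {x | a + (k + 1) * (b - a) ≤ inner ℝ x θ} *
            μ {x | a ≤ inner ℝ x θ} ^ k) := by gcongr
      _ ≤ 2 ^ k * q ^ (k + 1) := by
          gcongr
          exact (hμ.measure_halfSpace_mul_pow_le θ a b k).trans (by gcongr)
      _ = q * (2 * q) ^ k := by ring
  calc ∫⁻ x, ENNReal.ofReal (inner ℝ x θ - b) ∂μ
      ≤ ∫⁻ x, ∑' k : ℕ, {z : ℝ | a + (k + 1) * (b - a) ≤ z}.indicator
          (fun _ => ENNReal.ofReal (b - a)) (inner ℝ x θ) ∂μ :=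
        lintegral_mono fun x => ofReal_sub_le_tsum_indicator hab _
    _ = ∑' k : ℕ, ENNReal.ofReal (b - a) * μ {x | a + (k + 1) * (b - a) ≤ inner ℝ x θ} := by
        rw [lintegral_tsum]
        swap
        · exact fun k => ((measurable_const.indicator measurableSet_Ici).comp hmeas).aemeasurable
        refine tsum_congr fun k => ?_
        rw [← lintegral_indicator_const (isClosed_halfSpace_ge θ _).measurableSet]
        rfl
    _ ≤ ∑' k : ℕ, ENNReal.ofReal (b - a) * (q * (2 * q) ^ k) := by
        gcongr with k; exact htail k
    _ = ENNReal.ofReal (b - a) * (q * (1 - 2 * q)⁻¹) := by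
        rw [ENNReal.tsum_mul_left, ENNReal.tsum_mul_left, ENNReal.tsum_geometric]
    _ ≤ ENNReal.ofReal (b - a) * (2 * q) := by
        have : (1 - 2 * q)⁻¹ ≤ 2 := by
          rw [ENNReal.inv_le_iff_inv_le]
          refine le_trans ?_ (tsub_le_tsub_left hq 1)
          rw [ENNReal.one_sub_inv_two]
        refine mul_le_mul' le_rfl ?_
        exact (mul_le_mul' le_rfl this).trans (mul_comm q 2).le

theorem IsLogConcaveMeasure.lintegral_ofReal_inner_lt_top (hμ : IsLogConcaveMeasure μ)
    (θ : EuclideanSpace ℝ (Fin n)) : ∫⁻ x, ENNReal.ofReal (inner ℝ x θ) ∂μ < ∞ := by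
  have h1 : Tendsto (fun k : ℕ => μ {x | -(k : ℝ) ≤ inner ℝ x θ}) atTop (𝓝 1) := by
    have := tendsto_measure_iUnion_atTop (μ := μ)
      (s := fun k : ℕ => {x : EuclideanSpace ℝ (Fin n) | -(k : ℝ) ≤ inner ℝ x θ}) (by
        intro i j hij x hx
        have : (i : ℝ) ≤ j := by exact_mod_cast hij
        have hx' : -(i : ℝ) ≤ inner ℝ x θ := hx
        change -(j : ℝ) ≤ inner ℝ x θ
        linarith)
    rwa [show (⋃ k : ℕ, {x : EuclideanSpace ℝ (Fin n) | -(k : ℝ) ≤ inner ℝ x θ}) = Set.univ from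
      Set.eq_univ_of_forall fun x => by
        obtain ⟨k, hk⟩ := exists_nat_ge (-inner ℝ x θ)
        exact Set.mem_iUnion.2 ⟨k, neg_le.1 hk⟩, measure_univ] at this
  have h2 : Tendsto (fun k : ℕ => μ {x | (k : ℝ) ≤ inner ℝ x θ}) atTop (𝓝 0) := by
    have := tendsto_measure_iInter_atTop (μ := μ)
      (s := fun k : ℕ => {x : EuclideanSpace ℝ (Fin n) | (k : ℝ) ≤ inner ℝ x θ})
      (fun k => (isClosed_halfSpace_ge θ _).measurableSet.nullMeasurableSet) (by
        intro i j hij x hx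
        have : (i : ℝ) ≤ j := by exact_mod_cast hij
        exact this.trans hx) ⟨0, measure_ne_top _ _⟩
    rwa [show (⋂ k : ℕ, {x : EuclideanSpace ℝ (Fin n) | (k : ℝ) ≤ inner ℝ x θ}) = ∅ from
      Set.eq_empty_of_forall_notMem fun x hx => by
        obtain ⟨k, hk⟩ := exists_nat_gt (inner ℝ x θ)
        exact absurd (Set.mem_iInter.1 hx k) (not_le.2 hk), measure_empty] at this
  obtain ⟨k, hk⟩ := (h1.eventually (lt_mem_nhds (show (2⁻¹ : ℝ≥0∞) < 1 by simp))).exists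
  obtain ⟨l, hl, hl0⟩ := ((h2.eventually (gt_mem_nhds (show (0 : ℝ≥0∞) < 4⁻¹ by simp))).and
    (eventually_gt_atTop 0)).exists
  have hl0' : (0 : ℝ) < l := by exact_mod_cast hl0
  have hk0 : (0 : ℝ) ≤ k := k.cast_nonneg
  have h4 : (2 : ℝ≥0∞) * 4⁻¹ ≤ 2⁻¹ := by
    rw [show (4 : ℝ≥0∞) = 2 * 2 by norm_num, ENNReal.mul_inv (by simp) (by simp), ← mul_assoc,
      ENNReal.mul_inv_cancel (by simp) (by simp), one_mul]
  have := hμ.lintegral_ofReal_inner_sub_le θ (by linarith) hk.le hl.le h4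
  calc ∫⁻ x, ENNReal.ofReal (inner ℝ x θ) ∂μ
      ≤ ∫⁻ x, (ENNReal.ofReal (inner ℝ x θ - l) + ENNReal.ofReal l) ∂μ := by
        refine lintegral_mono fun x => ?_
        refine le_trans (le_of_eq ?_) ENNReal.ofReal_add_le
        simp
    _ = ∫⁻ x, ENNReal.ofReal (inner ℝ x θ - l) ∂μ + ENNReal.ofReal l := by
        rw [lintegral_add_right _ measurable_const]; simp
    _ < ∞ := ENNReal.add_lt_top.2 ⟨this.trans_lt (ENNReal.mul_lt_top (by simp)
        ((h4.trans_lt (by simp)))), by simp⟩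

theorem IsLogConcaveMeasure.integrable_inner (hμ : IsLogConcaveMeasure μ)
    (θ : EuclideanSpace ℝ (Fin n)) : Integrable (fun x => inner ℝ x θ) μ := by
  refine ⟨by fun_prop, ?_⟩
  rw [hasFiniteIntegral_iff_norm]
  have h1 := hμ.lintegral_ofReal_inner_lt_top θ
  have h2 := hμ.lintegral_ofReal_inner_lt_top (-θ)
  refine lt_of_le_of_lt (lintegral_mono fun x => ?_) ((lintegral_add_left
    (by fun_prop) _).trans_lt (ENNReal.add_lt_top.2 ⟨h1, h2⟩))
  rw [inner_neg_right, Real.norm_eq_abs]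
  rcases le_total 0 (inner ℝ x θ) with h | h
  · rw [abs_of_nonneg h]; exact le_self_add
  · rw [abs_of_nonpos h]; exact le_add_self

/-- A centered log-concave marginal exceeds an eighth of its mean absolute value with probability
bounded away from zero. -/
theorem IsLogConcaveMeasure.le_measure_integral_abs_le (hμ : IsLogConcaveMeasure μ)
    (hc : IsCenteredMeasure μ) (θ : EuclideanSpace ℝ (Fin n))
    (hpos : 0 < ∫ x, |inner ℝ x θ| ∂μ) :
    32⁻¹ ≤ μ {x | (∫ x, |inner ℝ x θ| ∂μ) / 8 ≤ inner ℝ x θ} := by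
  have hint := hμ.integrable_inner θ
  -- Since the mean is zero, the positive part carries half of the mean absolute value.
  have hhalf : ∀ θ : EuclideanSpace ℝ (Fin n),
      ∫⁻ x, ENNReal.ofReal (inner ℝ x θ) ∂μ = ENNReal.ofReal ((∫ x, |inner ℝ x θ| ∂μ) / 2) := by
    intro θ
    have hint := hμ.integrable_inner θ
    have e : (∫ x, |inner ℝ x θ| ∂μ) / 2 = ∫ x, (|inner ℝ x θ| + inner ℝ x θ) / 2 ∂μ := by
      rw [integral_div, integral_add hint.abs hint, hc θ, add_zero]
    have hint' : Integrable (fun x => (|inner ℝ x θ| + inner ℝ x θ) / 2) μ :=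
      (hint.abs.add hint).div_const 2
    rw [e, ofReal_integral_eq_lintegral_ofReal hint' (ae_of_all _ fun x => by
        have := neg_abs_le (inner ℝ x θ : ℝ)
        simp only [Pi.zero_apply]
        linarith)]
    refine lintegral_congr fun x => ?_
    rcases le_total 0 (inner ℝ x θ) with h | h
    · rw [abs_of_nonneg h]; congr 1; ring
    · rw [abs_of_nonpos h, ENNReal.ofReal_of_nonpos h]; simp
  have hneg := hhalf (-θ)
  have hposi := hhalf θ
  simp only [inner_neg_right, abs_neg] at hneg
  set ν := ∫ x, |inner ℝ x θ| ∂μ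
  by_contra! hlt
  have hν : ENNReal.ofReal ν ≠ 0 := by simpa using hpos
  -- Markov's inequality for the negative part, whose mean is `ν / 2`.
  have hlow : 2⁻¹ ≤ μ {x | -ν ≤ inner ℝ x θ} := by
    have hmk : ENNReal.ofReal ν * μ {x | ν ≤ -inner ℝ x θ} ≤ ENNReal.ofReal ν * 2⁻¹ := by
      calc _ ≤ ENNReal.ofReal ν * μ {x | ENNReal.ofReal ν ≤ ENNReal.ofReal (-inner ℝ x θ)} := by
            gcongr
            intro hx
            exact ENNReal.ofReal_le_ofReal hx
        _ ≤ ENNReal.ofReal (ν / 2) := by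
            rw [← hneg]
            exact mul_meas_ge_le_lintegral (by fun_prop) _
        _ = _ := by
            rw [div_eq_mul_inv, ENNReal.ofReal_mul hpos.le, ENNReal.ofReal_inv_of_pos two_pos]
            simp
    have hmk' : μ {x | ν ≤ -inner ℝ x θ} ≤ 2⁻¹ :=
      (ENNReal.mul_le_mul_iff_right hν ENNReal.ofReal_ne_top).1 hmk
    have hcov : (1 : ℝ≥0∞) ≤ μ {x | -ν ≤ inner ℝ x θ} + 2⁻¹ := by
      rw [← measure_univ (μ := μ)]
      refine le_trans (measure_mono fun x _ => ?_) ((measure_union_le _ _).trans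
        (add_le_add_right hmk' _))
      rcases le_total (-ν) (inner ℝ x θ) with h | h
      · exact Or.inl h
      · exact Or.inr (by change ν ≤ -inner ℝ x θ; linarith)
    rw [← ENNReal.one_sub_inv_two]
    exact tsub_le_iff_right.2 hcov
  have htail := hμ.lintegral_ofReal_inner_sub_le θ (by linarith) hlow hlt.le (by
    rw [show (32 : ℝ≥0∞) = 2 * 16 by norm_num, ENNReal.mul_inv (by simp) (by simp), ← mul_assoc,
      ENNReal.mul_inv_cancel (by simp) (by simp), one_mul]
    exact ENNReal.inv_le_inv.2 (by norm_num))
  -- The right side is `25ν/128 < ν/2`, the contradiction.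
  have hfinal : ENNReal.ofReal (ν / 2) ≤ ENNReal.ofReal ((ν / 8 - -ν) * (2 * 32⁻¹) + ν / 8) := by
    rw [ENNReal.ofReal_add (by linarith) (by linarith), ENNReal.ofReal_mul (by linarith)]
    calc ENNReal.ofReal (ν / 2) = ∫⁻ x, ENNReal.ofReal (inner ℝ x θ) ∂μ := hposi.symm
      _ ≤ ∫⁻ x, (ENNReal.ofReal (inner ℝ x θ - ν / 8) + ENNReal.ofReal (ν / 8)) ∂μ := by
          refine lintegral_mono fun x => ?_
          refine le_trans (le_of_eq ?_) ENNReal.ofReal_add_le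
          simp
      _ = ∫⁻ x, ENNReal.ofReal (inner ℝ x θ - ν / 8) ∂μ + ENNReal.ofReal (ν / 8) := by
          rw [lintegral_add_right _ measurable_const]; simp
      _ ≤ _ := by
          gcongr
          refine htail.trans (le_of_eq ?_)
          rw [ENNReal.ofReal_mul zero_le_two, ENNReal.ofReal_inv_of_pos (by norm_num)]
          simp
  rw [ENNReal.ofReal_le_ofReal_iff (by linarith)] at hfinal
  linarith

end Tails

/-! ### Grids and the cost of a missed cell. -/

/-- The cell of the grid of mesh `η` that contains `a`. -/
noncomputable def gridCell {n : ℕ} (η : ℝ) (a : Fin n → ℝ) : Fin n → ℤ := fun i => ⌊a i / η⌋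

/-- The cells of the grid that meet a box. -/
noncomputable def gridBox (n m : ℕ) : Finset (Fin n → ℤ) := Fintype.piFinset fun _ => Finset.Icc (-m : ℤ) m

theorem card_gridBox (n m : ℕ) : (gridBox n m).card = (2 * m + 1) ^ n := by
  rw [gridBox, Fintype.card_piFinset_const]
  congr 1
  simp
  omega

theorem gridCell_mem_gridBox {n m : ℕ} {η R : ℝ} (hη : 0 < η) (hm : R ≤ m * η) {a : Fin n → ℝ}
    (ha : ∀ i, |a i| ≤ R) : gridCell η a ∈ gridBox n m := by
  rw [gridBox, Fintype.mem_piFinset]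
  intro i
  obtain ⟨h1, h2⟩ := abs_le.1 ((ha i).trans hm)
  rw [Finset.mem_Icc, gridCell, Int.le_floor]
  constructor
  · push_cast
    rw [le_div_iff₀ hη]
    linarith
  · have : a i / η ≤ m := by rwa [div_le_iff₀ hη]
    exact_mod_cast (Int.floor_le _).trans this

theorem abs_sub_le_of_gridCell_eq {n : ℕ} {η : ℝ} (hη : 0 < η) {a b : Fin n → ℝ}
    (h : gridCell η a = gridCell η b) (i : Fin n) : |a i - b i| ≤ η := by
  have := (Int.abs_sub_lt_one_of_floor_eq_floor (congrFun h i)).le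
  rw [← sub_div, abs_div, abs_of_pos hη, div_le_one hη] at this
  exact this

/-- By Bernoulli, `N p q^N ≤ q^N (1 + p)^N = (1 - p²)^N ≤ 1`. No lower bound on `p` enters, so tiny
cells are harmless. -/
theorem ENNReal.mul_pow_le_natCast_inv {p q : ℝ≥0∞} (h : p + q = 1) (N : ℕ) :
    p * q ^ N ≤ (N : ℝ≥0∞)⁻¹ := by
  have hp : p ≠ ∞ := ne_top_of_le_ne_top ENNReal.one_ne_top (h ▸ le_self_add)
  have hq : q ≠ ∞ := ne_top_of_le_ne_top ENNReal.one_ne_top (h ▸ le_add_self)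
  lift p to NNReal using hp
  lift q to NNReal using hq
  have h' : (p : ℝ) + q = 1 := by exact_mod_cast h
  have hp0 : (0 : ℝ) ≤ p := p.2
  have hq0 : (0 : ℝ) ≤ q := q.2
  have key : (p : ℝ) * q ^ N * N ≤ 1 := by
    have hb := one_add_mul_le_pow (a := (p : ℝ)) (by linarith) N
    calc (p : ℝ) * q ^ N * N ≤ q ^ N * (1 + N * p) := by nlinarith [pow_nonneg hq0 N]
      _ ≤ q ^ N * (1 + p) ^ N := by gcongr
      _ = (1 - (p : ℝ) ^ 2) ^ N := by rw [← mul_pow]; congr 1; rw [← h']; ring_nf; nlinarith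
      _ ≤ 1 := pow_le_one₀ (by nlinarith) (by nlinarith)
  rw [ENNReal.le_inv_iff_mul_le]
  exact_mod_cast key

/-! ### Covering by the dilated random polytope. -/

section Main

variable {n : ℕ} {μ : Measure (EuclideanSpace ℝ (Fin n))} [IsProbabilityMeasure μ]

/-- A set `Q` is unlikely to have both large measure and no point of an independent sample. -/
theorem measure_mul_pi_forall_notMem_le {N : ℕ}
    {Q : Set (EuclideanSpace ℝ (Fin n))} (hQ : MeasurableSet Q) :
    μ Q * (Measure.pi fun _ : Fin N => μ) {X | ∀ j, X j ∉ Q} ≤ (N : ℝ≥0∞)⁻¹ := by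
  have : {X : Fin N → EuclideanSpace ℝ (Fin n) | ∀ j, X j ∉ Q} = Set.univ.pi fun _ => Qᶜ := by
    ext X; simp [Set.mem_pi]
  rw [this, Measure.pi_pi, Finset.prod_const, Finset.card_univ, Fintype.card_fin]
  exact ENNReal.mul_pow_le_natCast_inv (prob_add_prob_compl hQ) N

theorem measurableSet_forall_notMem {N : ℕ} {Q : Set (EuclideanSpace ℝ (Fin n))}
    (hQ : MeasurableSet Q) :
    MeasurableSet {X : Fin N → EuclideanSpace ℝ (Fin n) | ∀ j, X j ∉ Q} := by
  have : {X : Fin N → EuclideanSpace ℝ (Fin n) | ∀ j, X j ∉ Q} = Set.univ.pi fun _ => Qᶜ := by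
    ext X; simp [Set.mem_pi]
  rw [this]
  exact MeasurableSet.univ_pi fun _ => hQ.compl

/-- The mean absolute value of a linear functional admits an Auerbach basis. -/
theorem IsLogConcaveMeasure.exists_basis (hμ : IsLogConcaveMeasure μ) :
    ∃ b : Module.Basis (Fin n) ℝ (EuclideanSpace ℝ (Fin n)),
      (∀ i, ∫ x, |inner ℝ x (b i)| ∂μ = 1) ∧
      ∀ v i, |b.repr v i| ≤ ∫ x, |inner ℝ x v| ∂μ := by
  have hnorm : Integrable (fun x : EuclideanSpace ℝ (Fin n) => ‖x‖) μ := by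
    let e := EuclideanSpace.basisFun (Fin n) ℝ
    have hs : Integrable (fun x => ∑ i, |inner ℝ x (e i)|) μ :=
      integrable_finsetSum _ fun i _ => (hμ.integrable_inner (e i)).abs
    refine hs.mono' (by fun_prop) (ae_of_all _ fun x => ?_)
    rw [norm_norm]
    conv_lhs => rw [← e.sum_repr x]
    refine (norm_sum_le _ _).trans (Finset.sum_le_sum fun i _ => ?_)
    rw [norm_smul, e.norm_eq_one, mul_one, e.repr_apply_apply, real_inner_comm, Real.norm_eq_abs]
  refine exists_auerbach_basis (N := fun v => ∫ x, |inner ℝ x v| ∂μ) ?_ ?_ ?_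
  · refine continuous_iff_continuousAt.2 fun v => ?_
    refine continuousAt_of_dominated (bound := fun x => ‖x‖ * (‖v‖ + 1))
      (Eventually.of_forall fun w => by fun_prop) ?_ (hnorm.mul_const _)
      (ae_of_all _ fun x => by fun_prop)
    filter_upwards [(continuous_norm.tendsto v).eventually (gt_mem_nhds (lt_add_one ‖v‖))] with w hw
    refine ae_of_all _ fun x => ?_
    rw [Real.norm_eq_abs, abs_abs]
    exact (abs_real_inner_le_norm _ _).trans (by gcongr)
  · intro c v
    simp only [real_inner_smul_right, abs_mul]
    exact integral_const_mul _ _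
  · intro v hv
    refine (integral_nonneg fun x => abs_nonneg _).lt_of_ne fun h0 => ?_
    rw [eq_comm, integral_eq_zero_iff_of_nonneg (fun x => abs_nonneg _)
      (hμ.integrable_inner v).abs] at h0
    -- A zero norm would concentrate `μ` on the hyperplane `v^⊥`.
    refine (hμ.hyperplane_lt_one v 0 hv).ne ?_
    rw [← measure_univ (μ := μ)]
    refine measure_congr (h0.mono fun x hx => ?_)
    have hx' : inner ℝ x v = 0 := by simpa using hx
    have : inner ℝ v x = 0 := by rw [real_inner_comm]; exact hx'
    exact propext ⟨fun _ => trivial, fun _ => this⟩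

variable {b : Module.Basis (Fin n) ℝ (EuclideanSpace ℝ (Fin n))}

theorem measure_lt_sum_abs_inner_le (hμ : IsLogConcaveMeasure μ)
    (hb : ∀ i, ∫ x, |inner ℝ x (b i)| ∂μ = 1) {r : ℝ} (hr : 0 < r) :
    μ {x | r < ∑ i, |inner ℝ x (b i)|} ≤ ENNReal.ofReal (n / r) := by
  have hs : Integrable (fun x => ∑ i, |inner ℝ x (b i)|) μ :=
    integrable_finsetSum _ fun i _ => (hμ.integrable_inner (b i)).abs
  have hint : ∫ x, ∑ i, |inner ℝ x (b i)| ∂μ = n := by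
    rw [integral_finsetSum _ fun i _ => (hμ.integrable_inner (b i)).abs]
    simp [hb]
  have h := mul_meas_ge_le_integral_of_nonneg
    (ae_of_all _ fun x => Finset.sum_nonneg fun i _ => abs_nonneg _) hs r
  rw [hint] at h
  refine (measure_mono (t := {x | r ≤ ∑ i, |inner ℝ x (b i)|}) fun x hx => ?_).trans ?_
  · exact le_of_lt (show r < ∑ i, |inner ℝ x (b i)| from hx)
  rw [← ENNReal.ofReal_toReal (measure_ne_top μ _)]
  refine ENNReal.ofReal_le_ofReal ?_
  rw [le_div_iff₀ hr, mul_comm]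
  exact h

/-- Markov puts mass at most `1/64` beyond `64 n`, half of the `1/32` available. The bound on the
sum makes the first inequality stable under perturbing `v`. -/
theorem le_measure_le_inner_and_sum_le (hμ : IsLogConcaveMeasure μ) (hc : IsCenteredMeasure μ)
    (hn : 0 < n) (hb : ∀ i, ∫ x, |inner ℝ x (b i)| ∂μ = 1) {v : EuclideanSpace ℝ (Fin n)}
    (hv : 1 ≤ ∫ x, |inner ℝ x v| ∂μ) :
    64⁻¹ ≤ μ {x | 1 / 8 ≤ inner ℝ x v ∧ ∑ i, |inner ℝ x (b i)| ≤ 64 * n} := by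
  have hn' : (0 : ℝ) < n := by exact_mod_cast hn
  have h1 := hμ.le_measure_integral_abs_le hc v (by linarith)
  have h2 := measure_lt_sum_abs_inner_le hμ hb (r := 64 * n) (by positivity)
  have h3 : (n : ℝ) / (64 * n) = 64⁻¹ := by field_simp
  rw [h3, ENNReal.ofReal_inv_of_pos (by norm_num)] at h2
  have h4 : (32⁻¹ : ℝ≥0∞) = 64⁻¹ + 64⁻¹ := by
    rw [← two_mul, show (64 : ℝ≥0∞) = 2 * 32 by norm_num, ENNReal.mul_inv (by simp) (by simp),
      ← mul_assoc, ENNReal.mul_inv_cancel (by simp) (by simp), one_mul]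
  have h5 : (64⁻¹ : ℝ≥0∞) + 64⁻¹ ≤
      μ {x | 1 / 8 ≤ inner ℝ x v ∧ ∑ i, |inner ℝ x (b i)| ≤ 64 * n} + 64⁻¹ := by
    rw [← h4]
    refine h1.trans ((measure_mono fun x hx => ?_).trans ((measure_union_le _ _).trans
      (add_le_add_right (h2.trans (by simp)) _)))
    have hx' : (∫ x, |inner ℝ x v| ∂μ) / 8 ≤ inner ℝ x v := hx
    rcases le_or_gt (∑ i, |inner ℝ x (b i)|) (64 * n) with h | h
    · exact Or.inl ⟨by linarith, h⟩
    · exact Or.inr h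
  exact (ENNReal.add_le_add_iff_right (by simp)).1 h5

theorem abs_inner_sum_smul_le (a : Fin n → ℝ) {ε : ℝ} (ha : ∀ i, |a i| ≤ ε)
    (x : EuclideanSpace ℝ (Fin n)) :
    |inner ℝ x (∑ i, a i • b i)| ≤ ε * ∑ i, |inner ℝ x (b i)| := by
  rw [inner_sum, Finset.mul_sum]
  refine (Finset.abs_sum_le_sum_abs _ _).trans (Finset.sum_le_sum fun i _ => ?_)
  rw [real_inner_smul_right, abs_mul]
  exact mul_le_mul_of_nonneg_right (ha i) (abs_nonneg _)

/-- A polytope whose support function is large on the boundary of the coordinate cube contains a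
cross-polytope. -/
theorem mem_randomPolytope_of_sum_abs_inner_le {N : ℕ} (hN : 0 < N)
    {X : Fin N → EuclideanSpace ℝ (Fin n)} {r : ℝ}
    (h : ∀ a : Fin n → ℝ, (∀ i, |a i| ≤ 1) → (∃ i, |a i| = 1) →
      ∃ j, r ≤ inner ℝ (X j) (∑ i, a i • b i))
    {v : EuclideanSpace ℝ (Fin n)} (hv : ∑ i, |inner ℝ v (b i)| ≤ r) :
    v ∈ randomPolytope X := by
  by_contra hvK
  obtain ⟨f, u, hf, hu⟩ := geometric_hahn_banach_closed_point (convex_convexHull ℝ (Set.range X))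
    ((Set.finite_range X).isClosed_convexHull ℝ) hvK
  have hX : ∀ j, f (X j) < f v := fun j =>
    (hf _ (subset_convexHull ℝ _ (Set.mem_range_self j))).trans hu
  let y := (InnerProductSpace.toDual ℝ (EuclideanSpace ℝ (Fin n))).symm f
  have hy : ∀ x, f x = inner ℝ x y := fun x => by
    rw [real_inner_comm, InnerProductSpace.toDual_symm_apply]
  have hne : (Finset.univ : Finset (Fin n)).Nonempty := by
    by_contra hne
    have hy0 : y = 0 := by
      rw [← b.sum_repr y, Finset.not_nonempty_iff_eq_empty.1 hne, Finset.sum_empty]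
    have := hX ⟨0, hN⟩
    simp [hy, hy0] at this
  -- Dividing the separating functional by its largest coordinate puts it on the cube boundary,
  -- where the hypothesis applies.
  obtain ⟨i₀, -, hi₀⟩ := Finset.exists_max_image Finset.univ (fun i => |b.repr y i|) hne
  set M := |b.repr y i₀|
  have hM : 0 < M := by
    refine (abs_nonneg _).lt_of_ne fun h0 => ?_
    have hy0 : y = 0 := by
      rw [← b.sum_repr y]
      refine Finset.sum_eq_zero fun i hi => ?_
      rw [abs_nonpos_iff.1 ((hi₀ i hi).trans h0.symm.le), zero_smul]
    have := hX ⟨0, hN⟩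
    simp [hy, hy0] at this
  have hsum : ∑ i, (b.repr y i / M) • b i = M⁻¹ • y := by
    conv_rhs => rw [← b.sum_repr y, Finset.smul_sum]
    refine Finset.sum_congr rfl fun i _ => ?_
    rw [smul_smul, div_eq_inv_mul]
  have ha : ∀ i, |b.repr y i / M| ≤ 1 := fun i => by
    rw [abs_div, abs_of_pos hM, div_le_one hM]
    exact hi₀ i (Finset.mem_univ i)
  obtain ⟨j, hj⟩ := h (fun i => b.repr y i / M) ha ⟨i₀, by
    rw [abs_div, abs_of_pos hM]; exact div_self hM.ne'⟩
  have hv' := (le_abs_self _).trans (abs_inner_sum_smul_le (b := b) _ ha v)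
  rw [hsum, real_inner_smul_right] at hj hv'
  have hlt := hX j
  rw [hy, hy] at hlt
  have := mul_lt_mul_of_pos_left hlt (inv_pos.2 hM)
  linarith

/-- The points that look large in every direction of the cell `k` of the cube boundary. -/
def capSet (b : Module.Basis (Fin n) ℝ (EuclideanSpace ℝ (Fin n))) (ε : ℝ) (k : Fin n → ℤ) :
    Set (EuclideanSpace ℝ (Fin n)) :=
  {x | ∀ a : Fin n → ℝ, gridCell ε a = k → (∀ i, |a i| ≤ 1) → (∃ i, |a i| = 1) →
    1 / 16 ≤ inner ℝ x (∑ i, a i • b i)}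

theorem measurableSet_capSet (ε : ℝ) (k : Fin n → ℤ) : MeasurableSet (capSet b ε k) := by
  refine IsClosed.measurableSet ?_
  simp only [capSet, Set.ofPred_forall]
  exact isClosed_iInter fun a => isClosed_iInter fun _ => isClosed_iInter fun _ =>
    isClosed_iInter fun _ => isClosed_halfSpace_ge _ _

/-- One boundary point of the cell suffices: moving within the cell changes the inner product by at
most `64 n / (1024 n) = 1/16`, leaving `1/8 - 1/16`. A cell missing the boundary imposes no
condition. -/
theorem le_measure_capSet (hμ : IsLogConcaveMeasure μ) (hc : IsCenteredMeasure μ) (hn : 0 < n)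
    (hb : ∀ i, ∫ x, |inner ℝ x (b i)| ∂μ = 1)
    (hb' : ∀ v i, |b.repr v i| ≤ ∫ x, |inner ℝ x v| ∂μ) (k : Fin n → ℤ) :
    64⁻¹ ≤ μ (capSet b (1 / (1024 * n)) k) := by
  have hn' : (0 : ℝ) < n := by exact_mod_cast hn
  by_cases hk : ∃ a : Fin n → ℝ, gridCell (1 / (1024 * n)) a = k ∧ ∃ i, |a i| = 1
  · obtain ⟨a₀, ha₀, i₀, hi₀⟩ := hk
    have hv : 1 ≤ ∫ x, |inner ℝ x (∑ i, a₀ i • b i)| ∂μ := by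
      have := hb' (∑ i, a₀ i • b i) i₀
      rwa [b.repr_sum_self, hi₀] at this
    refine (le_measure_le_inner_and_sum_le hμ hc hn hb hv).trans (measure_mono ?_)
    rintro x ⟨hx1, hx2⟩ a ha _ _
    have hdiff := (neg_abs_le _).trans' (neg_le_neg (abs_inner_sum_smul_le (b := b)
      (fun i => a i - a₀ i)
      (abs_sub_le_of_gridCell_eq (by positivity) (ha.trans ha₀.symm)) x))
    simp only [sub_smul, Finset.sum_sub_distrib, inner_sub_right] at hdiff
    have : 1 / (1024 * (n : ℝ)) * ∑ i, |inner ℝ x (b i)| ≤ 1 / 16 := by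
      calc _ ≤ 1 / (1024 * (n : ℝ)) * (64 * n) := by gcongr
        _ = 1 / 16 := by field_simp; norm_num
    linarith
  · have : capSet b (1 / (1024 * n)) k = Set.univ :=
      Set.eq_univ_of_forall fun x a ha _ hi => absurd ⟨a, ha, hi⟩ hk
    rw [this, measure_univ]
    simp

/-- If every cap is hit, then a point in the same cell as a vertex lies in the dilated polytope. -/
theorem mem_smul_randomPolytope {N : ℕ} {δ : ℝ} (hδ : 0 < δ) (hn : 0 < n)
    {X : Fin N → EuclideanSpace ℝ (Fin n)}
    (hcap : ∀ k ∈ gridBox n (1024 * n), ∃ j, X j ∈ capSet b (1 / (1024 * n)) k)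
    {x : EuclideanSpace ℝ (Fin n)} {j : Fin N}
    (hxj : gridCell (δ / (16 * n)) (fun i => inner ℝ (X j) (b i)) =
      gridCell (δ / (16 * n)) (fun i => inner ℝ x (b i))) :
    x ∈ (1 + δ) • randomPolytope X := by
  have hn' : (0 : ℝ) < n := by exact_mod_cast hn
  -- Write `x = X j + δ u` with `u` in the inscribed cross-polytope; then `x / (1 + δ)` is a convex
  -- combination of `X j` and `u`.
  have hu : δ⁻¹ • (x - X j) ∈ randomPolytope X := by
    refine mem_randomPolytope_of_sum_abs_inner_le (b := b) j.pos (r := 1 / 16) ?_ ?_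
    · intro a ha hi
      obtain ⟨j, hj⟩ := hcap _ (gridCell_mem_gridBox (a := a) (η := 1 / (1024 * n)) (R := 1)
        (by positivity) (by push_cast; field_simp; rfl) ha)
      exact ⟨j, hj a rfl ha hi⟩
    · calc ∑ i, |inner ℝ (δ⁻¹ • (x - X j)) (b i)| ≤ ∑ _i : Fin n, δ⁻¹ * (δ / (16 * n)) := by
            refine Finset.sum_le_sum fun i _ => ?_
            rw [real_inner_smul_left, abs_mul, abs_of_pos (inv_pos.2 hδ), inner_sub_left]
            gcongr
            exact abs_sub_le_of_gridCell_eq (by positivity) hxj.symm i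
        _ = 1 / 16 := by simp; field_simp
  have hXj : X j ∈ randomPolytope X := subset_convexHull ℝ _ (Set.mem_range_self j)
  have hδ1 : 0 < 1 + δ := by linarith
  rw [Set.mem_smul_set_iff_inv_smul_mem₀ hδ1.ne']
  have := (convex_convexHull ℝ (Set.range X)) hXj hu (a := (1 + δ)⁻¹) (b := (1 + δ)⁻¹ * δ)
    (by positivity) (by positivity) (by field_simp)
  rw [randomPolytope]
  convert this using 1
  rw [mul_smul, ← smul_add, smul_inv_smul₀ hδ.ne', add_sub_cancel]

/-- Quantitative lower bound for the expected measure of the dilated random polytope. -/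
theorem one_le_expectedMeasureDilate_add (hμ : IsLogConcaveMeasure μ) (hc : IsCenteredMeasure μ)
    (hn : 0 < n) {N : ℕ} {δ : ℝ} (hδ : 0 < δ) {m : ℕ}
    (hm : 16 * (n : ℝ) ^ 3 ≤ m * δ) :
    1 ≤ expectedMeasureDilate μ N (1 + δ) + ((n : ℝ≥0∞)⁻¹ + ((2 * m + 1) ^ n : ℕ) * (N : ℝ≥0∞)⁻¹ +
      ((2 * (1024 * n) + 1) ^ n : ℕ) * (64 * (N : ℝ≥0∞)⁻¹)) := by
  have hn' : (0 : ℝ) < n := by exact_mod_cast hn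
  obtain ⟨b, hb, hb'⟩ := hμ.exists_basis
  let cell : EuclideanSpace ℝ (Fin n) → Fin n → ℤ := fun x =>
    gridCell (δ / (16 * n)) fun i => inner ℝ x (b i)
  have hcell : Measurable cell := by
    refine measurable_pi_lambda _ fun i => Int.measurable_floor.comp ?_
    fun_prop
  let Q : (Fin n → ℤ) → Set (EuclideanSpace ℝ (Fin n)) := fun k => cell ⁻¹' {k}
  let D := capSet b (1 / (1024 * n))
  have hQ : ∀ k, MeasurableSet (Q k) := fun k => hcell (measurableSet_singleton k)
  have hD : ∀ k, MeasurableSet (D k) := fun k => measurableSet_capSet _ k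
  let miss : Set (EuclideanSpace ℝ (Fin n)) → Set (Fin N → EuclideanSpace ℝ (Fin n)) :=
    fun S => {X | ∀ j, X j ∉ S}
  -- The sum has mean `n`, so the cutoff `n²` costs only `1/n`; `hm` makes `gridBox n m` cover the
  -- rest.
  let W : Set (EuclideanSpace ℝ (Fin n)) := {x | (n : ℝ) ^ 2 < ∑ i, |inner ℝ x (b i)|}
  have hW : μ W ≤ (n : ℝ≥0∞)⁻¹ := by
    refine (measure_lt_sum_abs_inner_le hμ hb (by positivity)).trans (le_of_eq ?_)
    rw [show (n : ℝ) / n ^ 2 = (n : ℝ)⁻¹ by field_simp, ENNReal.ofReal_inv_of_pos hn']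
    simp
  -- Far points, unhit cells weighted by their measure, and a full unit for each missed cap, since
  -- one miss voids the inclusion.
  let err : (Fin N → EuclideanSpace ℝ (Fin n)) → ℝ≥0∞ := fun X =>
    μ W + ∑ k ∈ gridBox n m, (miss (Q k)).indicator (fun _ => μ (Q k)) X +
      ∑ k ∈ gridBox n (1024 * n), (miss (D k)).indicator (fun _ => 1) X
  have hmissQ : ∀ k, MeasurableSet (miss (Q k)) := fun k => measurableSet_forall_notMem (hQ k)
  have hmissD : ∀ k, MeasurableSet (miss (D k)) := fun k => measurableSet_forall_notMem (hD k)
  have hsumQ : Measurable fun X => ∑ k ∈ gridBox n m, (miss (Q k)).indicator (fun _ => μ (Q k)) X :=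
    Finset.measurable_sum _ fun k _ => measurable_const.indicator (hmissQ k)
  have hsumD : Measurable fun X => ∑ k ∈ gridBox n (1024 * n),
      (miss (D k)).indicator (fun _ => (1 : ℝ≥0∞)) X :=
    Finset.measurable_sum _ fun k _ => measurable_const.indicator (hmissD k)
  have herr : Measurable err := (measurable_const.add hsumQ).add hsumD
  have hpt : ∀ X, 1 ≤ μ ((1 + δ) • randomPolytope X) + err X := by
    intro X
    by_cases hcap : ∀ k ∈ gridBox n (1024 * n), ∃ j, X j ∈ D k
    · have hcov : (Set.univ : Set (EuclideanSpace ℝ (Fin n))) ⊆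
          (1 + δ) • randomPolytope X ∪ (W ∪ ⋃ k ∈ gridBox n m, {x | x ∈ Q k ∧ X ∈ miss (Q k)}) := by
        intro x _
        by_cases hxW : x ∈ W
        · exact Or.inr (Or.inl hxW)
        have hxW' : ∑ i, |inner ℝ x (b i)| ≤ (n : ℝ) ^ 2 := not_lt.1 hxW
        by_cases hx : X ∈ miss (Q (cell x))
        · refine Or.inr (Or.inr (Set.mem_biUnion (x := cell x) ?_ ⟨rfl, hx⟩))
          refine gridCell_mem_gridBox (R := (n : ℝ) ^ 2) (by positivity) ?_ fun i => ?_
          · rw [← mul_div_assoc, le_div_iff₀ (by positivity)]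
            linarith
          · exact (Finset.single_le_sum (f := fun i => |inner ℝ x (b i)|)
              (fun i _ => abs_nonneg _) (Finset.mem_univ i)).trans hxW'
        · have hx' : ¬ ∀ j, X j ∉ Q (cell x) := hx
          push Not at hx'
          obtain ⟨j, hj⟩ := hx'
          exact Or.inl (mem_smul_randomPolytope hδ hn hcap hj)
      calc 1 = μ Set.univ := measure_univ.symm
        _ ≤ μ ((1 + δ) • randomPolytope X) + (μ W +
            ∑ k ∈ gridBox n m, μ {x | x ∈ Q k ∧ X ∈ miss (Q k)}) :=
          (measure_mono hcov).trans ((measure_union_le _ _).trans (add_le_add_right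
            ((measure_union_le _ _).trans (add_le_add_right
              (measure_biUnion_finset_le _ _) _)) _))
        _ ≤ μ ((1 + δ) • randomPolytope X) + err X := by
          refine add_le_add_right (le_trans (add_le_add_right
            (Finset.sum_le_sum fun k _ => ?_) _) le_self_add) _
          by_cases hk : X ∈ miss (Q k)
          · rw [Set.indicator_of_mem hk]
            exact measure_mono fun x hx => hx.1
          · simp [hk]
    · push Not at hcap
      obtain ⟨k, hk, hkX⟩ := hcap
      have hkX' : X ∈ miss (D k) := hkX
      calc (1 : ℝ≥0∞) = (miss (D k)).indicator (fun _ => 1) X :=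
            (Set.indicator_of_mem hkX' (fun _ => (1 : ℝ≥0∞))).symm
        _ ≤ ∑ k ∈ gridBox n (1024 * n), (miss (D k)).indicator (fun _ => 1) X :=
            Finset.single_le_sum
              (f := fun k => (miss (D k)).indicator (fun _ => (1 : ℝ≥0∞)) X)
              (fun _ _ => zero_le) hk
        _ ≤ _ := le_add_self.trans le_add_self
  calc (1 : ℝ≥0∞) = ∫⁻ _X : Fin N → EuclideanSpace ℝ (Fin n), 1 ∂(Measure.pi fun _ => μ) := by simp
    _ ≤ ∫⁻ X, (μ ((1 + δ) • randomPolytope X) + err X) ∂(Measure.pi fun _ => μ) :=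
        lintegral_mono hpt
    _ = expectedMeasureDilate μ N (1 + δ) + ∫⁻ X, err X ∂(Measure.pi fun _ => μ) :=
        lintegral_add_right _ herr
    _ ≤ _ := by
        refine add_le_add_right ?_ _
        rw [lintegral_add_right _ hsumD, lintegral_add_right _ hsumQ,
          lintegral_finsetSum _ fun k _ => measurable_const.indicator (hmissQ k),
          lintegral_finsetSum _ fun k _ => measurable_const.indicator (hmissD k)]
        simp only [lintegral_indicator_const (hmissQ _), lintegral_indicator_const (hmissD _),
          one_mul, lintegral_const, measure_univ, mul_one]
        refine add_le_add (add_le_add hW ?_) ?_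
        · rw [← card_gridBox, ← nsmul_eq_mul]
          exact Finset.sum_le_card_nsmul _ _ _ fun k _ => measure_mul_pi_forall_notMem_le (hQ k)
        · rw [← card_gridBox, ← nsmul_eq_mul]
          refine Finset.sum_le_card_nsmul _ _ _ fun k _ => ?_
          have h1 := le_measure_capSet hμ hc hn hb hb' k
          have h2 := measure_mul_pi_forall_notMem_le (μ := μ) (N := N) (hD k)
          calc (Measure.pi fun _ : Fin N => μ) (miss (D k))
              = 64 * (64⁻¹ * (Measure.pi fun _ : Fin N => μ) (miss (D k))) := by
                rw [← mul_assoc, ENNReal.mul_inv_cancel (by simp) (by simp), one_mul]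
            _ ≤ 64 * (N : ℝ≥0∞)⁻¹ := by
                gcongr
                exact (mul_le_mul' h1 le_rfl).trans h2

end Main

/-! ### Choice of constants and passage to the limit. -/

theorem IsLogConcaveMeasure.one_le_expectedMeasureDilate_add_div {n : ℕ}
    {μ : Measure (EuclideanSpace ℝ (Fin n))} [IsProbabilityMeasure μ] (hμ : IsLogConcaveMeasure μ)
    (hc : IsCenteredMeasure μ) {δ : ℝ} (hδ0 : 0 < δ) (hδ1 : δ < 1) (hn : 2049 ≤ n)
    (hnδ : 35 / δ ≤ n) {N : ℕ}
    (hN : Real.exp (8 * δ⁻¹ * Real.log (2 / δ) * n * Real.log n) ≤ N) :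
    1 ≤ expectedMeasureDilate μ N (1 + δ) + 66 * (n : ℝ≥0∞)⁻¹ := by
  have hn' : (2049 : ℝ) ≤ n := by exact_mod_cast hn
  have hn0 : 0 < n := by omega
  have hlog : 1 ≤ Real.log n := by
    rw [Real.le_log_iff_exp_le (by linarith)]
    linarith [Real.exp_one_lt_d9]
  have hNge : (n : ℝ) ^ (4 * n) * n ≤ N := by
    refine le_trans ?_ hN
    rw [← pow_succ, ← Real.exp_log (by positivity : (0 : ℝ) < n ^ (4 * n + 1)), Real.log_pow]
    refine Real.exp_le_exp.2 (mul_le_mul_of_nonneg_right ?_ (by linarith))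
    have h1 : 1 ≤ δ⁻¹ := (one_le_inv₀ hδ0).2 hδ1.le
    have h2 : Real.log 2 ≤ Real.log (2 / δ) :=
      Real.log_le_log two_pos (by rw [le_div_iff₀ hδ0]; linarith)
    have h3 := Real.log_two_gt_d9
    -- This crude bound suffices: `8 · 0.69 n ≥ 4 n + 1`. The finer dependence on `δ` is absorbed by
    -- `35 / δ ≤ n`.
    have h4 : 0.69 ≤ δ⁻¹ * Real.log (2 / δ) := by nlinarith
    push_cast
    nlinarith
  have key : ∀ k : ℕ, (k : ℝ) ≤ n ^ 4 → ((k ^ n : ℕ) : ℝ≥0∞) * (N : ℝ≥0∞)⁻¹ ≤ (n : ℝ≥0∞)⁻¹ := by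
    intro k hk
    have hk' : k ^ n * n ≤ N := by
      have : (k : ℝ) ^ n * n ≤ N := by
        refine le_trans ?_ hNge
        rw [pow_mul]
        gcongr
      exact_mod_cast this
    have hn1 : (n : ℝ≥0∞) ≠ 0 := by exact_mod_cast hn0.ne'
    rw [← div_eq_mul_inv]
    refine ENNReal.div_le_of_le_mul ?_
    rw [mul_comm, ← div_eq_mul_inv, ENNReal.le_div_iff_mul_le (Or.inl hn1)
      (Or.inl (ENNReal.natCast_ne_top n))]
    exact_mod_cast hk'
  have hm := Nat.le_ceil (16 * (n : ℝ) ^ 3 / δ)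
  have hm' := (Nat.ceil_lt_add_one (show 0 ≤ 16 * (n : ℝ) ^ 3 / δ by positivity)).le
  refine (one_le_expectedMeasureDilate_add (N := N) hμ hc hn0 hδ0 ((div_le_iff₀ hδ0).1 hm)).trans ?_
  refine add_le_add_right ?_ _
  have e : 66 * (n : ℝ≥0∞)⁻¹ = (n : ℝ≥0∞)⁻¹ + (n : ℝ≥0∞)⁻¹ + 64 * (n : ℝ≥0∞)⁻¹ := by ring
  rw [e, mul_left_comm]
  refine add_le_add (add_le_add le_rfl (key _ ?_)) (mul_le_mul' le_rfl (key _ ?_))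
  · push_cast
    have h1 : (1 : ℝ) ≤ (n : ℝ) ^ 3 / δ := by
      rw [le_div_iff₀ hδ0, one_mul]
      exact hδ1.le.trans (one_le_pow₀ (by linarith))
    calc 2 * (⌈16 * (n : ℝ) ^ 3 / δ⌉₊ : ℝ) + 1 ≤ 2 * (16 * (n : ℝ) ^ 3 / δ + 1) + 1 := by gcongr
      _ = 32 * ((n : ℝ) ^ 3 / δ) + 3 := by ring
      _ ≤ 35 / δ * n ^ 3 := by
        rw [div_mul_eq_mul_div, mul_div_assoc]
        linarith
      _ ≤ n * n ^ 3 := by gcongr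
      _ = n ^ 4 := by ring
  · push_cast
    have h1 : (n : ℝ) ^ 2 ≤ n ^ 4 := pow_le_pow_right₀ (by linarith) (by norm_num)
    nlinarith

theorem theorem1p5 :
    ∃ C : ℝ, 0 < C ∧ ∀ δ : ℝ, 0 < δ → δ < 1 →
      Tendsto
        (fun n : ℕ =>
          ⨅ (μ : Measure (EuclideanSpace ℝ (Fin n))) (_ : IsProbabilityMeasure μ)
            (_ : IsLogConcaveMeasure μ) (_ : IsCenteredMeasure μ)
            (N : ℕ) (_ : Real.exp (C * δ⁻¹ * Real.log (2 / δ) * n * Real.log n) ≤ (N : ℝ)),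
            expectedMeasureDilate μ N (1 + δ))
        atTop (𝓝 1) := by
  refine ⟨8, by norm_num, fun δ hδ0 hδ1 => ?_⟩
  have hlim : Tendsto (fun n : ℕ => 1 - 66 * (n : ℝ≥0∞)⁻¹) atTop (𝓝 1) := by
    have h1 : Tendsto (fun n : ℕ => 66 * (n : ℝ≥0∞)⁻¹) atTop (𝓝 (66 * 0)) :=
      ENNReal.Tendsto.const_mul ENNReal.tendsto_inv_nat_nhds_zero (Or.inr (by simp))
    have h2 := ENNReal.Tendsto.sub (tendsto_const_nhds (x := (1 : ℝ≥0∞))) h1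
      (Or.inl ENNReal.one_ne_top)
    simpa using h2
  refine tendsto_of_tendsto_of_tendsto_of_le_of_le' hlim tendsto_const_nhds ?_ ?_
  · filter_upwards [eventually_ge_atTop 2049,
      tendsto_natCast_atTop_atTop.eventually_ge_atTop (35 / δ)] with n hn hnδ
    refine le_iInf fun μ => le_iInf fun _ => le_iInf fun hμ => le_iInf fun hc => le_iInf fun N =>
      le_iInf fun hN => ?_
    exact tsub_le_iff_right.2 (hμ.one_le_expectedMeasureDilate_add_div hc hδ0 hδ1 hn hnδ hN)
  -- The cube and one admissible `N` bound the infimum by one.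
  · refine Eventually.of_forall fun n => ?_
    obtain ⟨N, hN⟩ := exists_nat_ge (Real.exp (8 * δ⁻¹ * Real.log (2 / δ) * n * Real.log n))
    refine (iInf_le_of_le (cubeMeasure n) <| iInf_le_of_le (inferInstance : IsProbabilityMeasure (cubeMeasure n)) <|
      iInf_le_of_le (isLogConcaveMeasure_cubeMeasure n) <|
      iInf_le_of_le (isCenteredMeasure_cubeMeasure n) <| iInf_le_of_le N <| iInf_le _ hN).trans ?_
    calc expectedMeasureDilate (cubeMeasure n) N (1 + δ)
        ≤ ∫⁻ _X : Fin N → EuclideanSpace ℝ (Fin n), 1 ∂(Measure.pi fun _ => cubeMeasure n) :=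
          lintegral_mono fun _ => prob_le_one
      _ = 1 := by simp
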